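/- **Setting.** The first-order terms of the language $\mathcal L$ are the numeric variables $\alpha,\beta,\dots$, $0$ and $\mathsf S(t)$; numerals are $\mathsf S\cdots\mathsf S0$. Atomic formulas are $\mathsf P(t_1,\dots,t_n)$ with one symbol for every primitive recursive relation on $\mathbb N$, and $\lnot\mathsf P$ denotes the atomic formula of the boolean negation; formulas are built from atomic ones with $\wedge,\vee,\to,\forall\alpha,\exists\alpha$. A closed atomic formula is $\mathsf{True}$ if the relation holds of its arguments. Everything is taken up to renaming of bound variables, and substitution avoids capture. The untyped proof terms of $\mathsf{HA}+\mathsf{NEM}$ are ($x$ a proof variable, $m$ a first-order term) $$t,u,v ::= x \mid tu \mid tm \mid \lambda x\,u \mid \lambda\alpha\,u \mid \langle t,u\rangle \mid \pi_0u \mid \pi_1u \mid \iota_0(u)\mid\iota_1(u)\mid t[x.u,y.v]\mid (m,t)\mid t[(\alpha,x).u]\mid u\parallel v\mid \mathsf H^{\forall\alpha\mathsf P}\mid\mathsf W^{\exists\alpha\lnot\mathsf P}\mid\mathsf{True}\mid \mathsf R\,u\,v\,m\mid \mathsf r\,t_1\dots t_n .$$ A context declares types for distinct proof variables $x,y,\dots$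 and for distinct hypothesis variables $a,b,\dots$. The judgement $\Gamma\vdash w:A$ of $\mathsf{HA}+\mathsf{NEM}$ is generated by the usual natural deduction rules with proof terms: $\Gamma,x:A\vdash x:A$; introduction and elimination for $\wedge$ ($\langle u,t\rangle$, $\pi_i u$), $\to$ ($\lambda x\,u$, $tu$), $\vee$ ($\iota_i(u)$, $t[x.u,y.v]$), $\forall$ ($\lambda\alpha\,u$, $um$), $\exists$ ($(m,u)$, $t[(\alpha,x).u]$), with the usual variable conditions for $\forall$-introduction and $\exists$-elimination with respect to all formulas of $\Gamma$; together with * induction: from $\Gamma\vdash u:A(0)$ and $\Gamma\vdash v:\forall\alpha.\,A(\alpha)\to A(\mathsf S\alpha)$ infer $\Gamma\vdash\mathsf R\,u\,v\,t:A(t)$, for any first-order term $t$; * Post rules: from $\Gamma\vdash u_i:\mathsf P_i$ ($i=1,\dots,n$) infer $\Gamma\vdash u:\mathsf Q$, where $\mathsf P_i,\mathsf Q$ are atomic, every substitution of closed first-order terms that makes all $\mathsf P_i$ true makes $\mathsf Q$ true, and $u=\mathsf r\,u_1\dots u_n$ if $n>0$, $u=\mathsf{True}$ if $n=0$; * $\Gamma,a:\forall\alpha\mathsf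 P\vdash\mathsf H^{\forall\alpha\mathsf P}:\forall\alpha\mathsf P$ and $\Gamma,a:\exists\alpha\lnot\mathsf P\vdash\mathsf W^{\exists\alpha\lnot\mathsf P}:\exists\alpha\lnot\mathsf P$, for $\mathsf P$ atomic; * from $\Gamma,a:\forall\alpha\mathsf P\vdash w_1:C$ and $\Gamma,a:\exists\alpha\lnot\mathsf P\vdash w_2:C$ infer $\Gamma\vdash w_1\parallel w_2:C$. One-step reduction $\rightsquigarrow$ is the closure, under all proof-term constructors, of: $(\lambda x\,u)t\rightsquigarrow u[t/x]$; $(\lambda\alpha\,u)m\rightsquigarrow u[m/\alpha]$; $\pi_i\langle u_0,u_1\rangle\rightsquigarrow u_i$; $\iota_i(u)[x_0.t_0,x_1.t_1]\rightsquigarrow t_i[u/x_i]$; $(n,u)[(\alpha,x).v]\rightsquigarrow v[n/\alpha][u/x]$; $\mathsf R\,u\,v\,0\rightsquigarrow u$; $\mathsf R\,u\,v\,(\mathsf Sn)\rightsquigarrow v\,n\,(\mathsf R\,u\,v\,n)$; $(u\parallel v)w\rightsquigarrow uw\parallel vw$ ($w$ a proof term or a first-order term); $\pi_i(u\parallel v)\rightsquigarrow\pi_iu\parallel\pi_iv$;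 $(u\parallel v)[x.w_1,y.w_2]\rightsquigarrow u[x.w_1,y.w_2]\parallel v[x.w_1,y.w_2]$; $(u\parallel v)[(\alpha,x).w]\rightsquigarrow u[(\alpha,x).w]\parallel v[(\alpha,x).w]$; $\mathsf H^{\forall\alpha\mathsf P}n\rightsquigarrow\mathsf{True}$ if $\mathsf P[n/\alpha]$ is closed and $\mathsf{True}$; $\mathsf W^{\exists\alpha\lnot\mathsf P}\rightsquigarrow(n,\mathsf{True})$; $u\parallel v\rightsquigarrow u$; $u\parallel v\rightsquigarrow v$. Here $m$ is any first-order term and $n$ any numeral. $\mathsf{SN}$ is the set of proof terms whose reduction tree is well-founded. Reducibility, $t\;\mathsf r\;C$, is defined by recursion on $C$: * $t\;\mathsf r\;\mathsf P$ iff $t\in\mathsf{SN}$, for $\mathsf P$ atomic; * $t\;\mathsf r\;A\wedge B$ iff $\pi_0t\;\mathsf r\;A$ and $\pi_1t\;\mathsf r\;B$; * $t\;\mathsf r\;A\to B$ iff $tu\;\mathsf r\;B$ for all $u\;\mathsf r\;A$; * $t\;\mathsf r\;A\vee B$ iff $t\in\mathsf{SN}$, $t\rightsquigarrow^*\iota_0(u)$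 implies $u\;\mathsf r\;A$, and $t\rightsquigarrow^*\iota_1(u)$ implies $u\;\mathsf r\;B$, for all $u$; * $t\;\mathsf r\;\forall\alpha A$ iff $tm\;\mathsf r\;A[m/\alpha]$ for every first-order term $m$; * $t\;\mathsf r\;\exists\alpha A$ iff $t\in\mathsf{SN}$ and, for every first-order term $m$ and every $u$, $t\rightsquigarrow^*(m,u)$ implies $u\;\mathsf r\;A[m/\alpha]$. **Theorem (Adequacy).** Suppose $\Gamma\vdash w:A$ in $\mathsf{HA}+\mathsf{NEM}$, where $\Gamma=x_1:A_1,\dots,x_n:A_n,\Delta$ and $\Delta$ contains no declarations of proof variables, and suppose that the free variables of the formulas occurring in $\Gamma$ and of $A$ are among the distinct variables $\alpha_1,\dots,\alpha_k$. Then, for all first-order terms $r_1,\dots,r_k$ and all proof terms $t_1,\dots,t_n$ such that $t_i\;\mathsf r\;A_i[r_1/\alpha_1\cdots r_k/\alpha_k]$ for $i=1,\dots,n$, $$w[t_1/x_1\cdots t_n/x_n\; r_1/\alpha_1\cdots r_k/\alpha_k]\;\;\mathsf r\;\;A[r_1/\alpha_1\cdots r_k/\alpha_k],$$ where the substitutions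 are simultaneous. -/

import Mathlib

namespace HANEM

/-! ## The arithmetical language

Syntax is taken modulo renaming of bound variables, by de Bruijn indices. There are two separate
classes of variables, each with its own indices: numeric variables and proof-term variables. -/

/-- First-order terms: numeric variables, `0`, and `S t`. -/
inductive Trm : Type
  | var : ℕ → Trm
  | zero : Trm
  | succ : Trm → Trm

/-- The numeral `S … S 0`. -/
def numeral : ℕ → Trm
  | 0 => Trm.zero
  | n + 1 => Trm.succ (numeral n)

/-- The sequence `a, s 0, s 1, …`. -/
def scons {X : Type} (a : X) (s : ℕ → X) : ℕ → X
  | 0 => a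
  | i + 1 => s i

namespace Trm

/-- Simultaneous substitution of `σ i` for the `i`-th numeric variable. -/
def subst (σ : ℕ → Trm) : Trm → Trm
  | var i => σ i
  | zero => zero
  | succ t => succ (t.subst σ)

/-- The variables of a term. -/
def fv : Trm → Set ℕ
  | var i => {i}
  | zero => ∅
  | succ t => t.fv

/-- The substitution that renames every numeric variable `i` to `i + 1`. -/
def shift : ℕ → Trm := fun i => var (i + 1)

/-- A substitution moved under a binder for a numeric variable. -/
def up (σ : ℕ → Trm) : ℕ → Trm := scons (var 0) (fun i => (σ i).subst shift)

/-- The substitution `[m/α]`, where `α` is the variable with index `0`. -/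
def single (m : Trm) : ℕ → Trm := scons m var

end Trm

/-- Predicate symbols: one for every primitive recursive relation on the natural numbers. -/
structure PredSym : Type where
  arity : ℕ
  rel : (Fin arity → ℕ) → Bool
  primrec : Primrec rel

/-- The symbol of the boolean negation. -/
def PredSym.neg (p : PredSym) : PredSym where
  arity := p.arity
  rel := fun v => !(p.rel v)
  primrec := Primrec.not.comp p.primrec

/-- Atomic formulas. -/
structure Atom : Type where
  sym : PredSym
  args : Fin sym.arity → Trm

namespace Atom

def subst (σ : ℕ → Trm) (P : Atom) : Atom := ⟨P.sym, fun i => (P.args i).subst σ⟩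

/-- `¬P`, the atomic formula for the boolean negation of `P`. -/
def neg (P : Atom) : Atom := ⟨P.sym.neg, P.args⟩

/-- `P = True`: the atom is closed (its arguments are numerals) and its relation holds. -/
def IsTrue (P : Atom) : Prop :=
  ∃ v : Fin P.sym.arity → ℕ, (∀ i, P.args i = numeral (v i)) ∧ P.sym.rel v = true

end Atom

/-- Formulas. In `all A` and `ex A` the variable with index `0` of `A` is bound. -/
inductive Formula : Type
  | atom : Atom → Formula
  | and : Formula → Formula → Formula
  | or : Formula → Formula → Formula
  | imp : Formula → Formula → Formula
  | all : Formula → Formula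
  | ex : Formula → Formula

namespace Formula

/-- Capture-avoiding simultaneous substitution for numeric variables. -/
def subst : (ℕ → Trm) → Formula → Formula
  | σ, atom P => atom (P.subst σ)
  | σ, and A B => and (A.subst σ) (B.subst σ)
  | σ, or A B => or (A.subst σ) (B.subst σ)
  | σ, imp A B => imp (A.subst σ) (B.subst σ)
  | σ, all A => all (A.subst (Trm.up σ))
  | σ, ex A => ex (A.subst (Trm.up σ))

/-- The free variables of a formula. -/
def fv : Formula → Set ℕ
  | atom P => ⋃ i, (P.args i).fv
  | and A B => A.fv ∪ B.fv
  | or A B => A.fv ∪ B.fv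
  | imp A B => A.fv ∪ B.fv
  | all A => {i | i + 1 ∈ A.fv}
  | ex A => {i | i + 1 ∈ A.fv}

/-- `A[m/α]`, for a formula `A` in which `α` is the variable with index `0`. -/
def inst (A : Formula) (m : Trm) : Formula := A.subst (Trm.single m)

/-- `A`, read in the scope of one more numeric variable (which is not free in it). -/
def shift (A : Formula) : Formula := A.subst Trm.shift

/-- The number of connectives and quantifiers. -/
def size : Formula → ℕ
  | atom _ => 0
  | and A B => A.size + B.size + 1
  | or A B => A.size + B.size + 1
  | imp A B => A.size + B.size + 1
  | all A => A.size + 1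
  | ex A => A.size + 1

theorem size_subst (A : Formula) : ∀ σ : ℕ → Trm, (A.subst σ).size = A.size := by
  induction A with
  | atom P => intro σ; rfl
  | and A B ihA ihB => intro σ; simp [subst, size, ihA, ihB]
  | or A B ihA ihB => intro σ; simp [subst, size, ihA, ihB]
  | imp A B ihA ihB => intro σ; simp [subst, size, ihA, ihB]
  | all A ih => intro σ; simp [subst, size, ih]
  | ex A ih => intro σ; simp [subst, size, ih]

theorem size_inst (A : Formula) (m : Trm) : (A.inst m).size = A.size := A.size_subst _

end Formula

/-! ## Untyped proof terms -/

/-- Untyped proof terms. -/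
inductive Tm : Type
  /-- `x` -/
  | var : ℕ → Tm
  /-- `t u` -/
  | app : Tm → Tm → Tm
  /-- `t m`, with `m` a first-order term -/
  | appT : Tm → Trm → Tm
  /-- `λx u`; binds the proof variable `0` -/
  | lam : Tm → Tm
  /-- `λα u`; binds the numeric variable `0` -/
  | lamT : Tm → Tm
  /-- `⟨t, u⟩` -/
  | pair : Tm → Tm → Tm
  /-- `π₀ u` -/
  | fst : Tm → Tm
  /-- `π₁ u` -/
  | snd : Tm → Tm
  /-- `ι₀(u)` -/
  | inl : Tm → Tm
  /-- `ι₁(u)` -/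
  | inr : Tm → Tm
  /-- `t[x.u, y.v]`; binds the proof variable `0` in `u` and in `v` -/
  | orE : Tm → Tm → Tm → Tm
  /-- `(m, t)` -/
  | exI : Trm → Tm → Tm
  /-- `t[(α, x).u]`; binds the numeric variable `0` and the proof variable `0` in `u` -/
  | exE : Tm → Tm → Tm
  /-- `u ∥ v`, the non-deterministic choice -/
  | par : Tm → Tm → Tm
  /-- `H^{∀α P}`; binds the numeric variable `0` of `P` -/
  | hyp : Atom → Tm
  /-- `W^{∃α ¬P}`; binds the numeric variable `0` of `P` -/
  | wit : Atom → Tm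
  /-- `True` -/
  | tt : Tm
  /-- `R u v m` -/
  | recN : Tm → Tm → Trm → Tm
  /-- `r t₁ … tₙ`, with the constant `r` -/
  | post : (n : ℕ) → (Fin n → Tm) → Tm

namespace Tm

/-- A renaming of proof variables moved under a binder for a proof variable. -/
def upRen (ρ : ℕ → ℕ) : ℕ → ℕ := scons 0 (fun i => ρ i + 1)

/-- Renaming `ρ` of the proof variables together with a substitution `σ` for the numeric ones. -/
def ren : (ℕ → ℕ) → (ℕ → Trm) → Tm → Tm
  | ρ, _, var i => var (ρ i)
  | ρ, σ, app t u => app (t.ren ρ σ) (u.ren ρ σ)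
  | ρ, σ, appT t m => appT (t.ren ρ σ) (m.subst σ)
  | ρ, σ, lam u => lam (u.ren (upRen ρ) σ)
  | ρ, σ, lamT u => lamT (u.ren ρ (Trm.up σ))
  | ρ, σ, pair t u => pair (t.ren ρ σ) (u.ren ρ σ)
  | ρ, σ, fst u => fst (u.ren ρ σ)
  | ρ, σ, snd u => snd (u.ren ρ σ)
  | ρ, σ, inl u => inl (u.ren ρ σ)
  | ρ, σ, inr u => inr (u.ren ρ σ)
  | ρ, σ, orE t u v => orE (t.ren ρ σ) (u.ren (upRen ρ) σ) (v.ren (upRen ρ) σ)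
  | ρ, σ, exI m t => exI (m.subst σ) (t.ren ρ σ)
  | ρ, σ, exE t u => exE (t.ren ρ σ) (u.ren (upRen ρ) (Trm.up σ))
  | ρ, σ, par u v => par (u.ren ρ σ) (v.ren ρ σ)
  | _, σ, hyp P => hyp (P.subst (Trm.up σ))
  | _, σ, wit P => wit (P.subst (Trm.up σ))
  | _, _, tt => tt
  | ρ, σ, recN u v m => recN (u.ren ρ σ) (v.ren ρ σ) (m.subst σ)
  | ρ, σ, post n us => post n (fun i => (us i).ren ρ σ)

/-- A substitution for proof variables moved under a binder for a proof variable. -/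
def up (τ : ℕ → Tm) : ℕ → Tm := scons (var 0) (fun i => (τ i).ren Nat.succ Trm.var)

/-- A substitution for proof variables moved under a binder for a numeric variable. -/
def upT (τ : ℕ → Tm) : ℕ → Tm := fun i => (τ i).ren id Trm.shift

/-- Capture-avoiding simultaneous substitution of `τ i` for the `i`-th proof variable and of
`σ j` for the `j`-th numeric variable. -/
def subst : (ℕ → Tm) → (ℕ → Trm) → Tm → Tm
  | τ, _, var i => τ i
  | τ, σ, app t u => app (t.subst τ σ) (u.subst τ σ)
  | τ, σ, appT t m => appT (t.subst τ σ) (m.subst σ)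
  | τ, σ, lam u => lam (u.subst (up τ) σ)
  | τ, σ, lamT u => lamT (u.subst (upT τ) (Trm.up σ))
  | τ, σ, pair t u => pair (t.subst τ σ) (u.subst τ σ)
  | τ, σ, fst u => fst (u.subst τ σ)
  | τ, σ, snd u => snd (u.subst τ σ)
  | τ, σ, inl u => inl (u.subst τ σ)
  | τ, σ, inr u => inr (u.subst τ σ)
  | τ, σ, orE t u v => orE (t.subst τ σ) (u.subst (up τ) σ) (v.subst (up τ) σ)
  | τ, σ, exI m t => exI (m.subst σ) (t.subst τ σ)
  | τ, σ, exE t u => exE (t.subst τ σ) (u.subst (up (upT τ)) (Trm.up σ))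
  | τ, σ, par u v => par (u.subst τ σ) (v.subst τ σ)
  | _, σ, hyp P => hyp (P.subst (Trm.up σ))
  | _, σ, wit P => wit (P.subst (Trm.up σ))
  | _, _, tt => tt
  | τ, σ, recN u v m => recN (u.subst τ σ) (v.subst τ σ) (m.subst σ)
  | τ, σ, post n us => post n (fun i => (us i).subst τ σ)

/-- `u[t/x]`, where `x` is the proof variable with index `0`. -/
def inst (u t : Tm) : Tm := u.subst (scons t var) Trm.var

/-- `u[m/α]`, where `α` is the numeric variable with index `0`. -/
def instT (u : Tm) (m : Trm) : Tm := u.subst var (Trm.single m)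

end Tm

/-! ## Typing -/

/-- A Post rule with premises `P i` and conclusion `Q`: every substitution of closed terms that
makes all premises true makes the conclusion true. -/
def IsPostRule {n : ℕ} (P : Fin n → Atom) (Q : Atom) : Prop :=
  ∀ σ : ℕ → Trm, (∀ j, (σ j).fv = ∅) → (∀ i, ((P i).subst σ).IsTrue) → (Q.subst σ).IsTrue

/-- `Derives Γ Δ w A`: the judgement `Γ, Δ ⊢ w : A`. The list `Γ` holds the
declarations of proof-term variables (the variable `i` has the `i`-th entry as its type), and `Δ`
holds the formulas declared for hypothesis variables, whose names do not occur in proof terms. -/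
inductive Derives : List Formula → List Formula → Tm → Formula → Prop
  | var {Γ Δ : List Formula} {i : ℕ} {A : Formula} :
      Γ[i]? = some A → Derives Γ Δ (Tm.var i) A
  | hyp {Γ Δ : List Formula} {P : Atom} :
      Formula.all (Formula.atom P) ∈ Δ →
      Derives Γ Δ (Tm.hyp P) (Formula.all (Formula.atom P))
  | wit {Γ Δ : List Formula} {P : Atom} :
      Formula.ex (Formula.atom P.neg) ∈ Δ →
      Derives Γ Δ (Tm.wit P) (Formula.ex (Formula.atom P.neg))
  | andI {Γ Δ : List Formula} {u t : Tm} {A B : Formula} :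
      Derives Γ Δ u A → Derives Γ Δ t B → Derives Γ Δ (Tm.pair u t) (Formula.and A B)
  | andE0 {Γ Δ : List Formula} {u : Tm} {A B : Formula} :
      Derives Γ Δ u (Formula.and A B) → Derives Γ Δ (Tm.fst u) A
  | andE1 {Γ Δ : List Formula} {u : Tm} {A B : Formula} :
      Derives Γ Δ u (Formula.and A B) → Derives Γ Δ (Tm.snd u) B
  | impE {Γ Δ : List Formula} {t u : Tm} {A B : Formula} :
      Derives Γ Δ t (Formula.imp A B) → Derives Γ Δ u A → Derives Γ Δ (Tm.app t u) B
  | impI {Γ Δ : List Formula} {u : Tm} {A B : Formula} :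
      Derives (A :: Γ) Δ u B → Derives Γ Δ (Tm.lam u) (Formula.imp A B)
  | orI0 {Γ Δ : List Formula} {u : Tm} {A B : Formula} :
      Derives Γ Δ u A → Derives Γ Δ (Tm.inl u) (Formula.or A B)
  | orI1 {Γ Δ : List Formula} {u : Tm} {A B : Formula} :
      Derives Γ Δ u B → Derives Γ Δ (Tm.inr u) (Formula.or A B)
  | orE {Γ Δ : List Formula} {u w₁ w₂ : Tm} {A B C : Formula} :
      Derives Γ Δ u (Formula.or A B) → Derives (A :: Γ) Δ w₁ C → Derives (B :: Γ) Δ w₂ C →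
      Derives Γ Δ (Tm.orE u w₁ w₂) C
  | allE {Γ Δ : List Formula} {u : Tm} {A : Formula} (m : Trm) :
      Derives Γ Δ u (Formula.all A) → Derives Γ Δ (Tm.appT u m) (A.inst m)
  | allI {Γ Δ : List Formula} {u : Tm} {A : Formula} :
      Derives (Γ.map Formula.shift) (Δ.map Formula.shift) u A →
      Derives Γ Δ (Tm.lamT u) (Formula.all A)
  | exI {Γ Δ : List Formula} {u : Tm} {A : Formula} (m : Trm) :
      Derives Γ Δ u (A.inst m) → Derives Γ Δ (Tm.exI m u) (Formula.ex A)
  | exE {Γ Δ : List Formula} {u t : Tm} {A C : Formula} :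
      Derives Γ Δ u (Formula.ex A) →
      Derives (A :: Γ.map Formula.shift) (Δ.map Formula.shift) t C.shift →
      Derives Γ Δ (Tm.exE u t) C
  | ind {Γ Δ : List Formula} {u v : Tm} {A : Formula} (t : Trm) :
      Derives Γ Δ u (A.inst Trm.zero) →
      Derives Γ Δ v
        (Formula.all (Formula.imp A (A.subst (scons (Trm.succ (Trm.var 0)) Trm.shift)))) →
      Derives Γ Δ (Tm.recN u v t) (A.inst t)
  | post {Γ Δ : List Formula} {n : ℕ} {P : Fin n → Atom} {Q : Atom} {u : Fin n → Tm} :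
      0 < n → IsPostRule P Q → (∀ i, Derives Γ Δ (u i) (Formula.atom (P i))) →
      Derives Γ Δ (Tm.post n u) (Formula.atom Q)
  | post0 {Γ Δ : List Formula} {P : Fin 0 → Atom} {Q : Atom} :
      IsPostRule P Q → Derives Γ Δ Tm.tt (Formula.atom Q)
  | nem {Γ Δ : List Formula} {w₁ w₂ : Tm} {P : Atom} {C : Formula} :
      Derives Γ (Formula.all (Formula.atom P) :: Δ) w₁ C →
      Derives Γ (Formula.ex (Formula.atom P.neg) :: Δ) w₂ C →
      Derives Γ Δ (Tm.par w₁ w₂) C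

/-! ## Reduction -/

/-- One-step reduction of proof terms. -/
inductive Step : Tm → Tm → Prop
  -- reduction rules for arithmetic
  | beta (u t : Tm) : Step (Tm.app (Tm.lam u) t) (u.inst t)
  | betaT (u : Tm) (m : Trm) : Step (Tm.appT (Tm.lamT u) m) (u.instT m)
  | fst_pair (u v : Tm) : Step (Tm.fst (Tm.pair u v)) u
  | snd_pair (u v : Tm) : Step (Tm.snd (Tm.pair u v)) v
  | orE_inl (u t₀ t₁ : Tm) : Step (Tm.orE (Tm.inl u) t₀ t₁) (t₀.inst u)
  | orE_inr (u t₀ t₁ : Tm) : Step (Tm.orE (Tm.inr u) t₀ t₁) (t₁.inst u)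
  | exE_exI (n : ℕ) (u v : Tm) :
      Step (Tm.exE (Tm.exI (numeral n) u) v)
        (v.subst (scons u Tm.var) (Trm.single (numeral n)))
  | rec_zero (u v : Tm) : Step (Tm.recN u v Trm.zero) u
  | rec_succ (u v : Tm) (n : ℕ) :
      Step (Tm.recN u v (Trm.succ (numeral n)))
        (Tm.app (Tm.appT v (numeral n)) (Tm.recN u v (numeral n)))
  -- permutation rules
  | par_app (u v w : Tm) : Step (Tm.app (Tm.par u v) w) (Tm.par (Tm.app u w) (Tm.app v w))
  | par_appT (u v : Tm) (m : Trm) :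
      Step (Tm.appT (Tm.par u v) m) (Tm.par (Tm.appT u m) (Tm.appT v m))
  | par_fst (u v : Tm) : Step (Tm.fst (Tm.par u v)) (Tm.par (Tm.fst u) (Tm.fst v))
  | par_snd (u v : Tm) : Step (Tm.snd (Tm.par u v)) (Tm.par (Tm.snd u) (Tm.snd v))
  | par_orE (u v w₁ w₂ : Tm) :
      Step (Tm.orE (Tm.par u v) w₁ w₂) (Tm.par (Tm.orE u w₁ w₂) (Tm.orE v w₁ w₂))
  | par_exE (u v w : Tm) : Step (Tm.exE (Tm.par u v) w) (Tm.par (Tm.exE u w) (Tm.exE v w))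
  -- non-deterministic rules
  | hyp (P : Atom) (n : ℕ) : (P.subst (Trm.single (numeral n))).IsTrue →
      Step (Tm.appT (Tm.hyp P) (numeral n)) Tm.tt
  | wit (P : Atom) (n : ℕ) : Step (Tm.wit P) (Tm.exI (numeral n) Tm.tt)
  | par_left (u v : Tm) : Step (Tm.par u v) u
  | par_right (u v : Tm) : Step (Tm.par u v) v
  -- reduction inside a term
  | app₁ {t t' : Tm} (u : Tm) : Step t t' → Step (Tm.app t u) (Tm.app t' u)
  | app₂ (t : Tm) {u u' : Tm} : Step u u' → Step (Tm.app t u) (Tm.app t u')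
  | appT {t t' : Tm} (m : Trm) : Step t t' → Step (Tm.appT t m) (Tm.appT t' m)
  | lam {u u' : Tm} : Step u u' → Step (Tm.lam u) (Tm.lam u')
  | lamT {u u' : Tm} : Step u u' → Step (Tm.lamT u) (Tm.lamT u')
  | pair₁ {t t' : Tm} (u : Tm) : Step t t' → Step (Tm.pair t u) (Tm.pair t' u)
  | pair₂ (t : Tm) {u u' : Tm} : Step u u' → Step (Tm.pair t u) (Tm.pair t u')
  | fst {u u' : Tm} : Step u u' → Step (Tm.fst u) (Tm.fst u')
  | snd {u u' : Tm} : Step u u' → Step (Tm.snd u) (Tm.snd u')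
  | inl {u u' : Tm} : Step u u' → Step (Tm.inl u) (Tm.inl u')
  | inr {u u' : Tm} : Step u u' → Step (Tm.inr u) (Tm.inr u')
  | orE₁ {t t' : Tm} (u v : Tm) : Step t t' → Step (Tm.orE t u v) (Tm.orE t' u v)
  | orE₂ (t : Tm) {u u' : Tm} (v : Tm) : Step u u' → Step (Tm.orE t u v) (Tm.orE t u' v)
  | orE₃ (t u : Tm) {v v' : Tm} : Step v v' → Step (Tm.orE t u v) (Tm.orE t u v')
  | exI (m : Trm) {t t' : Tm} : Step t t' → Step (Tm.exI m t) (Tm.exI m t')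
  | exE₁ {t t' : Tm} (u : Tm) : Step t t' → Step (Tm.exE t u) (Tm.exE t' u)
  | exE₂ (t : Tm) {u u' : Tm} : Step u u' → Step (Tm.exE t u) (Tm.exE t u')
  | par₁ {u u' : Tm} (v : Tm) : Step u u' → Step (Tm.par u v) (Tm.par u' v)
  | par₂ (u : Tm) {v v' : Tm} : Step v v' → Step (Tm.par u v) (Tm.par u v')
  | rec₁ {u u' : Tm} (v : Tm) (m : Trm) : Step u u' → Step (Tm.recN u v m) (Tm.recN u' v m)
  | rec₂ (u : Tm) {v v' : Tm} (m : Trm) : Step v v' → Step (Tm.recN u v m) (Tm.recN u v' m)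
  | post {n : ℕ} (us : Fin n → Tm) (i : Fin n) {u' : Tm} :
      Step (us i) u' → Step (Tm.post n us) (Tm.post n (Function.update us i u'))

/-- Reflexive and transitive closure of one-step reduction. -/
def Steps : Tm → Tm → Prop := Relation.ReflTransGen Step

/-- Strongly normalizable terms: the reduction tree is well-founded. -/
def SN (t : Tm) : Prop := Acc (fun t₁ t₂ => Step t₂ t₁) t

/-! ## Reducibility -/

/-- `Red C t`: the proof term `t` is reducible of type `C`. -/
def Red : Formula → Tm → Prop
  | Formula.atom _, t => SN t
  | Formula.and A B, t => Red A (Tm.fst t) ∧ Red B (Tm.snd t)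
  | Formula.imp A B, t => ∀ u : Tm, Red A u → Red B (Tm.app t u)
  | Formula.or A B, t => SN t ∧ (∀ u : Tm, Steps t (Tm.inl u) → Red A u) ∧
      (∀ u : Tm, Steps t (Tm.inr u) → Red B u)
  | Formula.all A, t => ∀ n : Trm, Red (A.inst n) (Tm.appT t n)
  | Formula.ex A, t => SN t ∧
      ∀ (n : Trm) (u : Tm), Steps t (Tm.exI n u) → Red (A.inst n) u
termination_by C => C.size
decreasing_by
  all_goals simp only [Formula.size, Formula.size_inst]; omega

end HANEM

namespace HANEM

/-! ## Substitution calculus -/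

/-! The method is Tait–Girard reducibility. By induction on the type, reducible terms are strongly
normalizing, closed under reduction, and include every neutral term whose one-step reducts are all
reducible (`isCandidate`). Adequacy is then an induction on derivations, done for arbitrary
simultaneous substitutions so that crossing a binder merely adds one entry (`Derives.red_subst`).
Each rule is matched by a lemma saying that its term constructor preserves reducibility. For binding
constructors, strong normalization of the body comes from that of an instance, because reduction is
stable under substitution (`Step.subst`, `SN.of_subst`).

Three points are specific to this calculus. First, a choice is not neutral, since the permutation
rules let it interact with an elimination. `Red.par` shows by induction on the type that it is
nevertheless reducible when both branches are: at `∧`, `→`, `∀` the elimination moves into the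
branches, and at `∨`, `∃` an introduction form reached from the choice is already reached from a
branch.

Second, permuting a case elimination over `u ∥ v` duplicates the elimination. The induction survives
because `u ∥ v` itself reduces to `u` and to `v`, so both are smaller in the reduction order.

Third, the constants `H` and `W` are reducible outright: their instances are atomic, and at an atom
reducibility is strong normalization, with no appeal to truth. -/

theorem numeral_subst (σ : ℕ → Trm) (n : ℕ) : (numeral n).subst σ = numeral n := by
  induction n with
  | zero => rfl
  | succ n ih => simp [numeral, Trm.subst, ih]

/-! ### Substitution in first-order terms, atoms and formulas. -/

namespace Trm

theorem subst_subst (t : Trm) (σ σ' : ℕ → Trm) :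
    (t.subst σ).subst σ' = t.subst (fun i => (σ i).subst σ') := by
  induction t with
  | var i => rfl
  | zero => rfl
  | succ t ih => simp [subst, ih]

theorem subst_var (t : Trm) : t.subst var = t := by
  induction t with
  | var i => rfl
  | zero => rfl
  | succ t ih => simp [subst, ih]

theorem up_var : up var = var := by
  funext i; cases i <;> rfl

theorem up_comp (σ σ' : ℕ → Trm) :
    (fun i => (up σ i).subst (up σ')) = up (fun i => (σ i).subst σ') := by
  funext i
  cases i with
  | zero => rfl
  | succ i =>
    simp only [up, scons, subst_subst]
    rfl

theorem up_single (σ : ℕ → Trm) (m : Trm) :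
    (fun i => (up σ i).subst (single m)) = scons m σ := by
  funext i
  cases i with
  | zero => rfl
  | succ i =>
    simp only [up, scons, subst_subst]
    exact subst_var _

theorem single_comp (σ : ℕ → Trm) (m : Trm) :
    (fun i => (single m i).subst σ) = scons (m.subst σ) σ := by
  funext i; cases i <;> rfl

end Trm

namespace Atom

theorem subst_subst (P : Atom) (σ σ' : ℕ → Trm) :
    (P.subst σ).subst σ' = P.subst (fun i => (σ i).subst σ') := by
  simp [subst, Trm.subst_subst]

theorem subst_var (P : Atom) : P.subst Trm.var = P := by
  simp [subst, Trm.subst_var]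

/-- A true atom has numerals as arguments, and substitution leaves these fixed. -/
theorem IsTrue.subst {P : Atom} (h : P.IsTrue) (σ : ℕ → Trm) : (P.subst σ).IsTrue := by
  obtain ⟨v, hv, hr⟩ := h
  exact ⟨v, fun i => (congrArg (Trm.subst σ) (hv i)).trans (numeral_subst σ _), hr⟩

end Atom

namespace Formula

theorem subst_subst (A : Formula) (σ σ' : ℕ → Trm) :
    (A.subst σ).subst σ' = A.subst (fun i => (σ i).subst σ') := by
  induction A generalizing σ σ' with
  | atom P => simp [subst, Atom.subst_subst]
  | and A B ihA ihB => simp [subst, ihA, ihB]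
  | or A B ihA ihB => simp [subst, ihA, ihB]
  | imp A B ihA ihB => simp [subst, ihA, ihB]
  | all A ih => simp [subst, ih, Trm.up_comp]
  | ex A ih => simp [subst, ih, Trm.up_comp]

theorem subst_up_inst (A : Formula) (σ : ℕ → Trm) (m : Trm) :
    (A.subst (Trm.up σ)).inst m = A.subst (scons m σ) := by
  rw [inst, subst_subst, Trm.up_single]

theorem inst_subst (A : Formula) (σ : ℕ → Trm) (m : Trm) :
    (A.inst m).subst σ = A.subst (scons (m.subst σ) σ) := by
  rw [inst, subst_subst, Trm.single_comp]

theorem shift_subst_scons (A : Formula) (σ : ℕ → Trm) (m : Trm) :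
    A.shift.subst (scons m σ) = A.subst σ := by
  rw [shift, subst_subst]; rfl

/-- Induction on formulas in which the hypotheses for a quantified formula concern all its
instances. -/
theorem inst_induction {motive : Formula → Prop} (atom : ∀ P, motive (atom P))
    (and : ∀ A B, motive A → motive B → motive (and A B))
    (or : ∀ A B, motive A → motive B → motive (or A B))
    (imp : ∀ A B, motive A → motive B → motive (imp A B))
    (all : ∀ A, (∀ m, motive (A.inst m)) → motive (all A))
    (ex : ∀ A, (∀ m, motive (A.inst m)) → motive (ex A)) (C : Formula) : motive C := by
  suffices h : ∀ n, ∀ C : Formula, C.size < n → motive C from h _ C (Nat.lt_succ_self _)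
  intro n
  induction n with
  | zero => intro C h; omega
  | succ n ih =>
    intro C h
    cases C <;> simp only [size] at h
    case atom P => exact atom P
    case and A B => exact and A B (ih A (by omega)) (ih B (by omega))
    case or A B => exact or A B (ih A (by omega)) (ih B (by omega))
    case imp A B => exact imp A B (ih A (by omega)) (ih B (by omega))
    case all A => exact all A fun m => ih _ (by rw [size_inst]; omega)
    case ex A => exact ex A fun m => ih _ (by rw [size_inst]; omega)

end Formula

/-! ### Substitution in proof terms. -/

namespace Tm

theorem up_var_comp (ρ : ℕ → ℕ) : up (fun i => var (ρ i)) = fun i => var (upRen ρ i) := by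
  funext i; cases i <;> rfl

theorem ren_eq_subst (t : Tm) (ρ : ℕ → ℕ) (σ : ℕ → Trm) :
    t.ren ρ σ = t.subst (fun i => var (ρ i)) σ := by
  induction t generalizing ρ σ with
  | lamT u ih => rw [ren, subst, ih]; rfl
  | exE t u iht ihu => rw [ren, subst, iht, ihu, ← up_var_comp]; rfl
  | _ => simp only [ren, subst, up_var_comp, *]

theorem up_upRen (τ : ℕ → Tm) (ρ : ℕ → ℕ) :
    (fun i => up τ (upRen ρ i)) = up (fun i => τ (ρ i)) := by
  funext i; cases i <;> rfl

/-- Moving a substitution under a binder renames its values. Hence composition is proved in stages: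
a renaming followed by a substitution, then the reverse order, and only then two substitutions. -/
theorem ren_subst (t : Tm) (ρ : ℕ → ℕ) (σ : ℕ → Trm) (τ : ℕ → Tm) (σ' : ℕ → Trm) :
    (t.ren ρ σ).subst τ σ' = t.subst (fun i => τ (ρ i)) (fun i => (σ i).subst σ') := by
  induction t generalizing ρ σ τ σ' with
  | lamT u ih => rw [ren, subst, subst, ih, Trm.up_comp]; rfl
  | exE t u iht ihu => rw [ren, subst, subst, iht, ihu, up_upRen, Trm.up_comp]; rfl
  | _ => simp only [ren, subst, up_upRen, Trm.subst_subst, Atom.subst_subst, Trm.up_comp, *]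

theorem ren_ren (t : Tm) (ρ ρ' : ℕ → ℕ) (σ σ' : ℕ → Trm) :
    (t.ren ρ σ).ren ρ' σ' = t.ren (fun i => ρ' (ρ i)) (fun i => (σ i).subst σ') := by
  rw [ren_eq_subst, ren_subst, ren_eq_subst]

theorem up_ren (τ : ℕ → Tm) (ρ : ℕ → ℕ) (σ : ℕ → Trm) :
    (fun i => (up τ i).ren (upRen ρ) σ) = up (fun i => (τ i).ren ρ σ) := by
  funext i
  cases i with
  | zero => rfl
  | succ i =>
    simp only [up, scons, ren_ren, Trm.subst_var]
    rfl

theorem upT_ren (τ : ℕ → Tm) (ρ : ℕ → ℕ) (σ : ℕ → Trm) :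
    (fun i => (upT τ i).ren ρ (Trm.up σ)) = upT (fun i => (τ i).ren ρ σ) := by
  funext i
  simp only [upT, ren_ren]
  rfl

theorem subst_ren (t : Tm) (τ : ℕ → Tm) (σ : ℕ → Trm) (ρ : ℕ → ℕ) (σ' : ℕ → Trm) :
    (t.subst τ σ).ren ρ σ' =
      t.subst (fun i => (τ i).ren ρ σ') (fun i => (σ i).subst σ') := by
  induction t generalizing ρ σ τ σ' <;>
    simp only [ren, subst, up_ren, upT_ren, Trm.subst_subst, Atom.subst_subst, Trm.up_comp, *]

theorem up_subst (τ τ' : ℕ → Tm) (σ : ℕ → Trm) :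
    (fun i => (up τ i).subst (up τ') σ) = up (fun i => (τ i).subst τ' σ) := by
  funext i
  cases i with
  | zero => rfl
  | succ i =>
    simp only [up, scons, ren_subst, subst_ren, Trm.subst_var]
    rfl

theorem upT_subst (τ τ' : ℕ → Tm) (σ : ℕ → Trm) :
    (fun i => (upT τ i).subst (upT τ') (Trm.up σ)) = upT (fun i => (τ i).subst τ' σ) := by
  funext i
  simp only [upT, ren_subst, subst_ren]
  rfl

theorem subst_subst (t : Tm) (τ τ' : ℕ → Tm) (σ σ' : ℕ → Trm) :
    (t.subst τ σ).subst τ' σ' =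
      t.subst (fun i => (τ i).subst τ' σ') (fun i => (σ i).subst σ') := by
  induction t generalizing τ τ' σ σ' <;>
    simp only [subst, up_subst, upT_subst, Trm.subst_subst, Atom.subst_subst, Trm.up_comp, *]

theorem subst_var (t : Tm) : t.subst var Trm.var = t := by
  have h : up var = var := by funext i; cases i <;> rfl
  have hT : upT var = var := rfl
  induction t with
  | lamT u ih => rw [subst, hT, Trm.up_var, ih]
  | exE t u iht ihu => rw [subst, hT, h, Trm.up_var, iht, ihu]
  | _ => simp only [subst, Trm.up_var, Trm.subst_var, Atom.subst_var, *]

theorem up_scons (τ : ℕ → Tm) (u : Tm) :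
    (fun i => (up τ i).subst (scons u var) Trm.var) = scons u τ := by
  funext i
  cases i with
  | zero => rfl
  | succ i =>
    simp only [up, scons, ren_subst, Trm.subst_var]
    exact subst_var _

theorem upT_single (τ : ℕ → Tm) (m : Trm) :
    (fun i => (upT τ i).subst var (Trm.single m)) = τ := by
  funext i
  simp only [upT, ren_subst]
  exact subst_var _

theorem up_upT_scons (τ : ℕ → Tm) (u : Tm) (m : Trm) :
    (fun i => (up (upT τ) i).subst (scons u var) (Trm.single m)) = scons u τ := by
  funext i
  cases i with
  | zero => rfl
  | succ i =>
    simp only [up, upT, scons, ren_subst]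
    exact subst_var _

/-- This and the next two lemmas turn the contractum of a redex whose body was substituted under its
binder into one simultaneous substitution, the form in which the induction hypothesis of adequacy
applies. -/
theorem subst_up_inst (w : Tm) (τ : ℕ → Tm) (σ : ℕ → Trm) (u : Tm) :
    (w.subst (up τ) σ).inst u = w.subst (scons u τ) σ := by
  simp only [inst, subst_subst, up_scons, Trm.subst_var]

theorem subst_upT_instT (w : Tm) (τ : ℕ → Tm) (σ : ℕ → Trm) (m : Trm) :
    (w.subst (upT τ) (Trm.up σ)).instT m = w.subst τ (scons m σ) := by
  simp only [instT, subst_subst, upT_single, Trm.up_single]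

theorem subst_up_upT_inst (w : Tm) (τ : ℕ → Tm) (σ : ℕ → Trm) (u : Tm) (m : Trm) :
    (w.subst (up (upT τ)) (Trm.up σ)).subst (scons u var) (Trm.single m) =
      w.subst (scons u τ) (scons m σ) := by
  simp only [subst_subst, up_upT_scons, Trm.up_single]

theorem scons_var_subst (τ : ℕ → Tm) (σ : ℕ → Trm) (u : Tm) :
    (fun i => (scons u var i).subst τ σ) = scons (u.subst τ σ) τ := by
  funext i; cases i <;> rfl

theorem inst_subst (w u : Tm) (τ : ℕ → Tm) (σ : ℕ → Trm) :
    (w.inst u).subst τ σ = (w.subst (up τ) σ).inst (u.subst τ σ) := by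
  rw [subst_up_inst, inst, subst_subst, scons_var_subst]; rfl

theorem instT_subst (w : Tm) (m : Trm) (τ : ℕ → Tm) (σ : ℕ → Trm) :
    (w.instT m).subst τ σ = (w.subst (upT τ) (Trm.up σ)).instT (m.subst σ) := by
  rw [subst_upT_instT, instT, subst_subst, Trm.single_comp]; rfl

end Tm

/-! ## Reduction and strong normalization -/

theorem Step.subst {t t' : Tm} (h : Step t t') (τ : ℕ → Tm) (σ : ℕ → Trm) :
    Step (t.subst τ σ) (t'.subst τ σ) := by
  induction h generalizing τ σ with
  | beta u t => rw [Tm.inst_subst]; exact Step.beta _ _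
  | betaT u m => rw [Tm.instT_subst]; exact Step.betaT _ _
  | orE_inl u t₀ t₁ => rw [Tm.inst_subst]; exact Step.orE_inl _ _ _
  | orE_inr u t₀ t₁ => rw [Tm.inst_subst]; exact Step.orE_inr _ _ _
  | exE_exI n u v =>
    rw [Tm.subst_subst, Tm.scons_var_subst, Trm.single_comp, ← Tm.subst_up_upT_inst]
    simp only [Tm.subst, numeral_subst]
    exact Step.exE_exI _ _ _
  | rec_succ u v n =>
    simp only [Tm.subst, Trm.subst, numeral_subst]
    exact Step.rec_succ _ _ _
  | hyp P n hP =>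
    simp only [Tm.subst, numeral_subst]
    refine Step.hyp _ n ?_
    have := hP.subst σ
    rwa [Atom.subst_subst, Trm.single_comp, numeral_subst, ← Trm.up_single,
      ← Atom.subst_subst] at this
  | wit P n => simp only [Tm.subst, numeral_subst]; exact Step.wit _ _
  | post us i h ih =>
    -- Substituting componentwise commutes with updating one component.
    simp only [Tm.subst]
    convert Step.post (fun j => (us j).subst τ σ) i (ih τ σ) using 2
    funext j
    by_cases hj : j = i
    · subst hj; simp
    · simp [hj]
  | _ => constructor <;> apply_assumption

theorem SN.step {t t' : Tm} (h : SN t) (hs : Step t t') : SN t' := Acc.inv h hs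

/-- A context that preserves reduction steps reflects strong normalization. -/
theorem SN.of_map {f : Tm → Tm} (hf : ∀ t t', Step t t' → Step (f t) (f t')) {t : Tm}
    (h : SN (f t)) : SN t :=
  Subrelation.accessible (fun h => hf _ _ h) (InvImage.accessible f h)

theorem SN.of_subst {t : Tm} {τ : ℕ → Tm} {σ : ℕ → Trm} (h : SN (t.subst τ σ)) : SN t :=
  SN.of_map (f := fun t => t.subst τ σ) (fun _ _ h => h.subst τ σ) h

/-- Accessibility induction that keeps `SN t` available in the motive. -/
theorem SN.induction {motive : ∀ t : Tm, SN t → Prop}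
    (ind : ∀ (t : Tm) (h : SN t), (∀ (t' : Tm) (hs : Step t t'), motive t' (h.step hs)) →
      motive t h) {t : Tm} (h : SN t) : motive t h := by
  induction h with
  | intro t h ih => exact ind t ⟨t, h⟩ ih

theorem SN.intro {t : Tm} (h : ∀ t', Step t t' → SN t') : SN t := Acc.intro t h

theorem SN.par {u v : Tm} (hu : SN u) (hv : SN v) : SN (Tm.par u v) := by
  induction hu using SN.induction generalizing v with
  | ind u hu ihu =>
  induction hv using SN.induction with
  | ind v hv ihv =>
  refine SN.intro fun s hs => ?_
  cases hs with
  | par_left => exact hu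
  | par_right => exact hv
  | par₁ _ h => exact ihu _ h hv
  | par₂ _ h => exact ihv _ h

theorem SN.tt : SN Tm.tt := SN.intro fun _ h => nomatch h

theorem SN.inl {u : Tm} (hu : SN u) : SN (Tm.inl u) := by
  induction hu using SN.induction with
  | ind u hu ih =>
  refine SN.intro fun s hs => ?_
  cases hs with
  | inl h => exact ih _ h

theorem SN.inr {u : Tm} (hu : SN u) : SN (Tm.inr u) := by
  induction hu using SN.induction with
  | ind u hu ih =>
  refine SN.intro fun s hs => ?_
  cases hs with
  | inr h => exact ih _ h

theorem SN.exI {u : Tm} (m : Trm) (hu : SN u) : SN (Tm.exI m u) := by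
  induction hu using SN.induction with
  | ind u hu ih =>
  refine SN.intro fun s hs => ?_
  cases hs with
  | exI _ h => exact ih _ h

/-- There are infinitely many reducts, one per numeral, but each is strongly normalizing;
well-foundedness needs no finite branching. -/
theorem SN.wit (P : Atom) : SN (Tm.wit P) := by
  refine SN.intro fun s hs => ?_
  cases hs with
  | wit _ n => exact SN.tt.exI _

theorem SN.appT_hyp (P : Atom) (m : Trm) : SN (Tm.appT (Tm.hyp P) m) := by
  refine SN.intro fun s hs => ?_
  cases hs with
  | hyp => exact SN.tt
  | appT _ h => nomatch h

/-- A step changes a single component, so the tuple decreases lexicographically. Restricting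
components to strongly normalizing terms makes reduction well-founded. -/
theorem SN.post {n : ℕ} {us : Fin n → Tm} (h : ∀ i, SN (us i)) : SN (Tm.post n us) := by
  let r : {t : Tm // SN t} → {t : Tm // SN t} → Prop := fun a b => Step b.1 a.1
  have hr : WellFounded r := by
    refine ⟨fun ⟨t, ht⟩ => ?_⟩
    induction ht using SN.induction with
    | ind t ht ih => exact ⟨_, fun s hs => ih s.1 hs⟩
  have hwf : WellFounded (Pi.Lex (fun a b : Fin n => a < b) (fun {_} => r)) :=
    Pi.Lex.wellFounded _ fun _ => hr
  suffices H : ∀ vs : Fin n → {t : Tm // SN t}, SN (Tm.post n fun i => (vs i).1) from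
    H fun i => ⟨us i, h i⟩
  intro vs
  induction vs using hwf.induction with
  | _ vs ih =>
  refine SN.intro fun s hs => ?_
  cases hs with
  | post _ i hi =>
    have := ih (Function.update vs i ⟨_, (vs i).2.step hi⟩)
      ⟨i, fun j hj => Function.update_of_ne hj.ne _ _, by simpa [r] using hi⟩
    convert this using 2
    funext j
    by_cases hj : j = i
    · subst hj; simp
    · simp [hj]

/-! ### Reducts of injections, witness pairs and choices. -/

theorem Steps.of_inl {u s : Tm} (h : Steps (Tm.inl u) s) : ∃ u', s = Tm.inl u' ∧ Steps u u' := by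
  induction h with
  | refl => exact ⟨u, rfl, .refl⟩
  | tail _ hs ih =>
    obtain ⟨u', rfl, hu⟩ := ih
    cases hs with
    | inl h => exact ⟨_, rfl, hu.tail h⟩

theorem Steps.of_inr {u s : Tm} (h : Steps (Tm.inr u) s) : ∃ u', s = Tm.inr u' ∧ Steps u u' := by
  induction h with
  | refl => exact ⟨u, rfl, .refl⟩
  | tail _ hs ih =>
    obtain ⟨u', rfl, hu⟩ := ih
    cases hs with
    | inr h => exact ⟨_, rfl, hu.tail h⟩

theorem Steps.of_exI {m : Trm} {u s : Tm} (h : Steps (Tm.exI m u) s) :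
    ∃ u', s = Tm.exI m u' ∧ Steps u u' := by
  induction h with
  | refl => exact ⟨u, rfl, .refl⟩
  | tail _ hs ih =>
    obtain ⟨u', rfl, hu⟩ := ih
    cases hs with
    | exI _ h => exact ⟨_, rfl, hu.tail h⟩

/-- Up to the first selection of a branch only the two branches reduce; the steps made inside the
selected branch are then prepended to what follows the selection. -/
theorem Steps.of_par {u v s : Tm} (h : Steps (Tm.par u v) s) :
    (∃ u' v', s = Tm.par u' v') ∨ Steps u s ∨ Steps v s := by
  generalize ht : Tm.par u v = t at h
  induction h using Relation.ReflTransGen.head_induction_on generalizing u v with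
  | refl => exact .inl ⟨u, v, ht.symm⟩
  | head hs hss ih =>
    subst ht
    cases hs with
    | par_left => exact .inr (.inl hss)
    | par_right => exact .inr (.inr hss)
    | par₁ _ h => exact (ih rfl).imp_right (.imp_left fun h' => .head h h')
    | par₂ _ h => exact (ih rfl).imp_right (.imp_right fun h' => .head h h')

/-! ## Reducibility candidates -/

/-- Terms that form no redex together with an elimination applied to them. -/
def Neutral : Tm → Prop
  | Tm.lam _ | Tm.lamT _ | Tm.pair _ _ | Tm.inl _ | Tm.inr _ | Tm.exI _ _ | Tm.par _ _
  | Tm.hyp _ => False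
  | _ => True

/-- Reducible terms of type `C` are strongly normalizable, closed under reduction, and contain
every neutral term whose one-step reducts are reducible. -/
structure IsCandidate (C : Formula) : Prop where
  sn : ∀ {t}, Red C t → SN t
  step : ∀ {t t'}, Red C t → Step t t' → Red C t'
  neutral : ∀ {t}, Neutral t → (∀ t', Step t t' → Red C t') → Red C t

theorem IsCandidate.var {C : Formula} (h : IsCandidate C) (i : ℕ) : Red C (Tm.var i) :=
  h.neutral trivial fun _ hs => nomatch hs

theorem isCandidate_and {A B : Formula} (hA : IsCandidate A) (hB : IsCandidate B) :
    IsCandidate (Formula.and A B) where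
  sn h := by
    rw [Red] at h
    exact SN.of_map (fun _ _ => Step.fst) (hA.sn h.1)
  step h hs := by
    rw [Red] at h ⊢
    exact ⟨hA.step h.1 hs.fst, hB.step h.2 hs.snd⟩
  neutral hn h := by
    simp only [Red] at h ⊢
    constructor
    · refine hA.neutral trivial fun s hs => ?_
      cases hs with
      | fst hs => exact (h _ hs).1
      | fst_pair | par_fst => exact hn.elim
    · refine hB.neutral trivial fun s hs => ?_
      cases hs with
      | snd hs => exact (h _ hs).2
      | snd_pair | par_snd => exact hn.elim

theorem isCandidate_imp {A B : Formula} (hA : IsCandidate A) (hB : IsCandidate B) :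
    IsCandidate (Formula.imp A B) where
  sn h := by
    rw [Red] at h
    -- Variables are reducible of every type, so the term may be applied to one, and reduction in
    -- head position is reflected.
    exact SN.of_map (f := fun t => Tm.app t (Tm.var 0)) (fun _ _ => Step.app₁ _)
      (hB.sn (h _ (hA.var 0)))
  step h hs := by
    rw [Red] at h ⊢
    exact fun u hu => hB.step (h u hu) (hs.app₁ u)
  neutral hn h := by
    simp only [Red] at h ⊢
    intro u hu
    induction hA.sn hu using SN.induction with
    | ind u _ ih =>
    refine hB.neutral trivial fun s hs => ?_
    cases hs with
    | app₁ _ hs => exact h _ hs u hu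
    | app₂ _ hs => exact ih _ hs (hA.step hu hs)
    | beta | par_app => exact hn.elim

/-- Normalization and closure under reduction are built into the definition here, so nothing is
needed of the components. -/
theorem isCandidate_or {A B : Formula} : IsCandidate (Formula.or A B) where
  sn h := by rw [Red] at h; exact h.1
  step h hs := by
    rw [Red] at h ⊢
    exact ⟨h.1.step hs, fun u hu => h.2.1 u (hu.head hs), fun u hu => h.2.2 u (hu.head hs)⟩
  neutral hn h := by
    simp only [Red] at h ⊢
    refine ⟨SN.intro fun s hs => (h s hs).1, fun u hu => ?_, fun u hu => ?_⟩
    -- A neutral term is not an injection, so the reduction has a first step.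
    · obtain rfl | ⟨s, hs, hu⟩ := Relation.ReflTransGen.cases_head hu
      · exact hn.elim
      · exact (h s hs).2.1 u hu
    · obtain rfl | ⟨s, hs, hu⟩ := Relation.ReflTransGen.cases_head hu
      · exact hn.elim
      · exact (h s hs).2.2 u hu

theorem isCandidate_all {A : Formula} (hA : ∀ m, IsCandidate (A.inst m)) :
    IsCandidate (Formula.all A) where
  sn h := by
    rw [Red] at h
    exact SN.of_map (f := fun t => Tm.appT t Trm.zero) (fun _ _ => Step.appT _)
      ((hA _).sn (h Trm.zero))
  step h hs := by
    rw [Red] at h ⊢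
    exact fun m => (hA m).step (h m) (hs.appT m)
  neutral hn h := by
    simp only [Red] at h ⊢
    intro m
    refine (hA m).neutral trivial fun s hs => ?_
    cases hs with
    | appT _ hs => exact h _ hs m
    | betaT | par_appT | hyp => exact hn.elim

theorem isCandidate_ex {A : Formula} : IsCandidate (Formula.ex A) where
  sn h := by rw [Red] at h; exact h.1
  step h hs := by
    rw [Red] at h ⊢
    exact ⟨h.1.step hs, fun m u hu => h.2 m u (hu.head hs)⟩
  neutral hn h := by
    simp only [Red] at h ⊢
    refine ⟨SN.intro fun s hs => (h s hs).1, fun m u hu => ?_⟩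
    obtain rfl | ⟨s, hs, hu⟩ := Relation.ReflTransGen.cases_head hu
    · exact hn.elim
    · exact (h s hs).2 m u hu

theorem isCandidate (C : Formula) : IsCandidate C := by
  induction C using Formula.inst_induction with
  | atom P =>
    refine ⟨fun h => ?_, fun h hs => ?_, fun _ h => ?_⟩ <;> simp only [Red] at h ⊢
    exacts [h, h.step hs, SN.intro h]
  | and A B hA hB => exact isCandidate_and hA hB
  | or A B hA hB => exact isCandidate_or
  | imp A B hA hB => exact isCandidate_imp hA hB
  | all A hA => exact isCandidate_all hA
  | ex A hA => exact isCandidate_ex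

theorem Red.sn {C : Formula} {t : Tm} (h : Red C t) : SN t := (isCandidate C).sn h

theorem Red.step {C : Formula} {t t' : Tm} (h : Red C t) (hs : Step t t') : Red C t' :=
  (isCandidate C).step h hs

theorem Red.steps {C : Formula} {t t' : Tm} (h : Red C t) (hs : Steps t t') : Red C t' := by
  induction hs with
  | refl => exact h
  | tail _ hs ih => exact ih.step hs

theorem Red.neutral {C : Formula} {t : Tm} (hn : Neutral t) (h : ∀ t', Step t t' → Red C t') :
    Red C t := (isCandidate C).neutral hn h

theorem Red.var (C : Formula) (i : ℕ) : Red C (Tm.var i) := (isCandidate C).var i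

/-! ## Reducibility of the term constructors -/

/-- An eliminator `f` sends a choice between strongly normalizable terms to a reducible term, if
reducible results on both branches can be merged. -/
theorem Red.elim_par {C : Formula} {f : Tm → Tm} (hn : ∀ t, Neutral (f t))
    (hstep : ∀ t t', Step t t' → Step (f t) (f t'))
    (hf : ∀ u v s, Step (f (Tm.par u v)) s →
      s = Tm.par (f u) (f v) ∨ ∃ t', Step (Tm.par u v) t' ∧ s = f t')
    (hpar : ∀ u v, Red C u → Red C v → Red C (Tm.par u v)) {u v : Tm} (hu : SN u) (hv : SN v)
    (hfu : Red C (f u)) (hfv : Red C (f v)) : Red C (f (Tm.par u v)) := by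
  induction hu using SN.induction generalizing v with
  | ind u _ ihu =>
  induction hv using SN.induction with
  | ind v hv ihv =>
  refine Red.neutral (hn _) fun s hs => ?_
  obtain rfl | ⟨t', ht', rfl⟩ := hf u v s hs
  · exact hpar _ _ hfu hfv
  · cases ht' with
    | par_left => exact hfu
    | par_right => exact hfv
    | par₁ _ h => exact ihu _ h hv (hfu.step (hstep _ _ h)) hfv
    | par₂ _ h => exact ihv _ h (hfv.step (hstep _ _ h))

/-- At `→` the argument can reduce as well, so `Red.elim_par` does not apply and a third induction,
on the argument, is needed. At `∨` and `∃` a reduct of the choice that is an introduction form comes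
from one branch. -/
theorem Red.par {C : Formula} {u v : Tm} (hu : Red C u) (hv : Red C v) :
    Red C (Tm.par u v) := by
  have su := hu.sn
  have sv := hv.sn
  induction C using Formula.inst_induction generalizing u v with
  | atom P => rw [Red]; exact su.par sv
  | and A B hA hB =>
    rw [Red] at hu hv ⊢
    constructor
    · refine Red.elim_par (f := Tm.fst) (fun _ => trivial) (fun _ _ => Step.fst) ?_
        (fun u v hu hv => hA hu hv hu.sn hv.sn) su sv hu.1 hv.1
      intro u v s hs
      cases hs with
      | par_fst => exact .inl rfl
      | fst h => exact .inr ⟨_, h, rfl⟩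
    · refine Red.elim_par (f := Tm.snd) (fun _ => trivial) (fun _ _ => Step.snd) ?_
        (fun u v hu hv => hB hu hv hu.sn hv.sn) su sv hu.2 hv.2
      intro u v s hs
      cases hs with
      | par_snd => exact .inl rfl
      | snd h => exact .inr ⟨_, h, rfl⟩
  | or A B hA hB =>
    rw [Red] at hu hv ⊢
    refine ⟨su.par sv, fun w hw => ?_, fun w hw => ?_⟩
    · obtain ⟨_, _, h⟩ | h | h := hw.of_par
      · cases h
      · exact hu.2.1 w h
      · exact hv.2.1 w h
    · obtain ⟨_, _, h⟩ | h | h := hw.of_par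
      · cases h
      · exact hu.2.2 w h
      · exact hv.2.2 w h
  | imp A B hA hB =>
    rw [Red] at hu hv ⊢
    intro w hw
    have hfu := hu w hw
    have hfv := hv w hw
    clear hu hv
    induction hw.sn using SN.induction generalizing u v with
    | ind w _ ihw =>
    induction su using SN.induction generalizing v with
    | ind u su ihu =>
    induction sv using SN.induction with
    | ind v sv ihv =>
    refine Red.neutral trivial fun s hs => ?_
    cases hs with
    | par_app => exact hB hfu hfv hfu.sn hfv.sn
    | app₂ _ h => exact ihw _ h su sv (hw.step h) (hfu.step (h.app₂ _)) (hfv.step (h.app₂ _))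
    | app₁ _ h =>
      cases h with
      | par_left => exact hfu
      | par_right => exact hfv
      | par₁ _ h => exact ihu _ h sv (hfu.step (h.app₁ _)) hfv
      | par₂ _ h => exact ihv _ h (hfv.step (h.app₁ _))
  | all A hA =>
    rw [Red] at hu hv ⊢
    intro m
    refine Red.elim_par (f := fun t => Tm.appT t m) (fun _ => trivial) (fun _ _ => Step.appT m) ?_
      (fun u v hu hv => hA m hu hv hu.sn hv.sn) su sv (hu m) (hv m)
    intro u v s hs
    cases hs with
    | par_appT => exact .inl rfl
    | appT _ h => exact .inr ⟨_, h, rfl⟩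
  | ex A hA =>
    rw [Red] at hu hv ⊢
    refine ⟨su.par sv, fun m w hw => ?_⟩
    obtain ⟨_, _, h⟩ | h | h := hw.of_par
    · cases h
    · exact hu.2 m w h
    · exact hv.2 m w h

theorem Red.pair {A B : Formula} {u v : Tm} (hu : Red A u) (hv : Red B v) :
    Red (Formula.and A B) (Tm.pair u v) := by
  have su := hu.sn
  have sv := hv.sn
  induction su using SN.induction generalizing v with
  | ind u su ihu =>
  induction sv using SN.induction with
  | ind v sv ihv =>
  simp only [Red] at ihu ihv ⊢
  constructor
  · refine Red.neutral trivial fun s hs => ?_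
    cases hs with
    | fst_pair => exact hu
    | fst h =>
      cases h with
      | pair₁ _ h => exact (ihu _ h (hu.step h) hv sv).1
      | pair₂ _ h => exact (ihv _ h (hv.step h)).1
  · refine Red.neutral trivial fun s hs => ?_
    cases hs with
    | snd_pair => exact hv
    | snd h =>
      cases h with
      | pair₁ _ h => exact (ihu _ h (hu.step h) hv sv).2
      | pair₂ _ h => exact (ihv _ h (hv.step h)).2

theorem Red.inl {A B : Formula} {u : Tm} (hu : Red A u) : Red (Formula.or A B) (Tm.inl u) := by
  rw [Red]
  refine ⟨hu.sn.inl, fun w hw => ?_, fun w hw => ?_⟩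
  · obtain ⟨u', h, hs⟩ := hw.of_inl
    cases h
    exact hu.steps hs
  · obtain ⟨u', h, -⟩ := hw.of_inl
    cases h

theorem Red.inr {A B : Formula} {u : Tm} (hu : Red B u) : Red (Formula.or A B) (Tm.inr u) := by
  rw [Red]
  refine ⟨hu.sn.inr, fun w hw => ?_, fun w hw => ?_⟩
  · obtain ⟨u', h, -⟩ := hw.of_inr
    cases h
  · obtain ⟨u', h, hs⟩ := hw.of_inr
    cases h
    exact hu.steps hs

theorem Red.exI {A : Formula} {m : Trm} {u : Tm} (hu : Red (A.inst m) u) :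
    Red (Formula.ex A) (Tm.exI m u) := by
  rw [Red]
  refine ⟨hu.sn.exI m, fun n w hw => ?_⟩
  obtain ⟨u', h, hs⟩ := hw.of_exI
  cases h
  exact hu.steps hs

/-- The second component of any pair reached is `True`, which is normal, and at an atom that
suffices whether or not the witness is correct. Hence the two atoms can be unrelated. -/
theorem Red.wit (P Q : Atom) : Red (Formula.ex (Formula.atom Q)) (Tm.wit P) := by
  rw [Red]
  refine ⟨SN.wit P, fun n w hw => ?_⟩
  obtain h | ⟨s, hs, hw⟩ := Relation.ReflTransGen.cases_head hw
  · cases h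
  · cases hs with
    | wit _ k =>
      obtain ⟨u', h, hs⟩ := Steps.of_exI hw
      cases h
      have htt : Red (Formula.atom (Q.subst (Trm.single (numeral k)))) Tm.tt := by
        rw [Red]; exact SN.tt
      exact htt.steps hs

theorem Red.hyp (P Q : Atom) : Red (Formula.all (Formula.atom Q)) (Tm.hyp P) := by
  rw [Red]
  intro m
  simp only [Formula.inst, Formula.subst, Red]
  exact SN.appT_hyp P m

theorem Red.lam {A B : Formula} {w : Tm} (h : ∀ u, Red A u → Red B (w.inst u)) :
    Red (Formula.imp A B) (Tm.lam w) := by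
  -- Instantiating at a variable suffices: a reducible instance is strongly normalizing, and the
  -- body inherits this.
  have sw : SN w := (h _ (Red.var A 0)).sn.of_subst
  rw [Red]
  intro u hu
  induction sw using SN.induction generalizing u with
  | ind w sw ihw =>
  induction hu.sn using SN.induction with
  | ind u _ ihu =>
  refine Red.neutral trivial fun s hs => ?_
  cases hs with
  | beta => exact h u hu
  | app₂ _ hs => exact ihu _ hs (hu.step hs)
  | app₁ _ hs =>
    cases hs with
    | lam hs => exact ihw _ hs (fun u hu => (h u hu).step (hs.subst _ _)) u hu

theorem Red.lamT {A : Formula} {w : Tm} (h : ∀ m, Red (A.inst m) (w.instT m)) :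
    Red (Formula.all A) (Tm.lamT w) := by
  have sw : SN w := (h Trm.zero).sn.of_subst
  rw [Red]
  intro m
  induction sw using SN.induction with
  | ind w sw ihw =>
  refine Red.neutral trivial fun s hs => ?_
  cases hs with
  | betaT => exact h m
  | appT _ hs =>
    cases hs with
    | lamT hs => exact ihw _ hs (fun m => (h m).step (hs.subst _ _))

/-! ### Case eliminations and recursion. -/

theorem Red.orE {A B C : Formula} {t w₁ w₂ : Tm} (ht : Red (Formula.or A B) t)
    (h₁ : ∀ u, Red A u → Red C (w₁.inst u)) (h₂ : ∀ u, Red B u → Red C (w₂.inst u)) :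
    Red C (Tm.orE t w₁ w₂) := by
  have s₁ : SN w₁ := (h₁ _ (Red.var A 0)).sn.of_subst
  have s₂ : SN w₂ := (h₂ _ (Red.var B 0)).sn.of_subst
  induction ht.sn using SN.induction generalizing w₁ w₂ with
  | ind t _ iht =>
  induction s₁ using SN.induction generalizing w₂ with
  | ind w₁ s₁ ih₁ =>
  induction s₂ using SN.induction with
  | ind w₂ s₂ ih₂ =>
  refine Red.neutral trivial fun s hs => ?_
  cases hs with
  | orE_inl u =>
    rw [Red] at ht
    exact h₁ _ (ht.2.1 u .refl)
  | orE_inr u =>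
    rw [Red] at ht
    exact h₂ _ (ht.2.2 u .refl)
  | par_orE u v =>
    -- Each branch is a one-step reduct of the eliminated choice, so the outer induction hypothesis
    -- covers both eliminations.
    exact Red.par
      (iht _ (Step.par_left u v) (ht.step (Step.par_left u v)) h₁ h₂ s₁ s₂)
      (iht _ (Step.par_right u v) (ht.step (Step.par_right u v)) h₁ h₂ s₁ s₂)
  | orE₁ _ _ hs => exact iht _ hs (ht.step hs) h₁ h₂ s₁ s₂
  | orE₂ _ _ hs => exact ih₁ _ hs (fun u hu => (h₁ u hu).step (hs.subst _ _)) h₂ s₂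
  | orE₃ _ _ hs => exact ih₂ _ hs (fun u hu => (h₂ u hu).step (hs.subst _ _))

theorem Red.exE {A C : Formula} {t w : Tm} (ht : Red (Formula.ex A) t)
    (h : ∀ m u, Red (A.inst m) u → Red C (w.subst (scons u Tm.var) (Trm.single m))) :
    Red C (Tm.exE t w) := by
  have sw : SN w := (h Trm.zero _ (Red.var _ 0)).sn.of_subst
  induction ht.sn using SN.induction generalizing w with
  | ind t _ iht =>
  induction sw using SN.induction with
  | ind w sw ihw =>
  refine Red.neutral trivial fun s hs => ?_
  cases hs with
  | exE_exI n u =>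
    rw [Red] at ht
    exact h _ _ (ht.2 _ u .refl)
  | par_exE u v =>
    exact Red.par
      (iht _ (Step.par_left u v) (ht.step (Step.par_left u v)) h sw)
      (iht _ (Step.par_right u v) (ht.step (Step.par_right u v)) h sw)
  | exE₁ _ hs => exact iht _ hs (ht.step hs) h sw
  | exE₂ _ hs => exact ihw _ hs (fun m u hu => (h m u hu).step (hs.subst _ _))

/-- The outer induction is on the first-order term, open terms included; recursion stuck at a
non-numeral has only steps inside `u` and `v`. -/
theorem Red.recN {A : Formula} {u v : Tm} (hu : Red (A.inst Trm.zero) u)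
    (hv : Red (Formula.all (Formula.imp A
      (A.subst (scons (Trm.succ (Trm.var 0)) Trm.shift)))) v) (m : Trm) :
    Red (A.inst m) (Tm.recN u v m) := by
  -- The inner induction, on normalization of both arguments. The unfolding is required for all
  -- reducible `u` and `v`, as these may have changed before the recursion rule fires.
  have key : ∀ {u v : Tm}, Red (A.inst Trm.zero) u → Red (Formula.all (Formula.imp A
      (A.subst (scons (Trm.succ (Trm.var 0)) Trm.shift)))) v → ∀ m : Trm,
      (∀ n, m = Trm.succ (numeral n) → ∀ u v, Red (A.inst Trm.zero) u →
        Red (Formula.all (Formula.imp A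
          (A.subst (scons (Trm.succ (Trm.var 0)) Trm.shift)))) v →
        Red (A.inst m) (Tm.app (Tm.appT v (numeral n)) (Tm.recN u v (numeral n)))) →
      Red (A.inst m) (Tm.recN u v m) := by
    intro u v hu hv m hs
    have su := hu.sn
    have sv := hv.sn
    induction su using SN.induction generalizing v with
    | ind u su ihu =>
    induction sv using SN.induction with
    | ind v sv ihv =>
    refine Red.neutral trivial fun s h => ?_
    cases h with
    | rec_zero => exact hu
    | rec_succ _ _ n => exact hs n rfl u v hu hv
    | rec₁ _ _ h => exact ihu _ h (hu.step h) hv sv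
    | rec₂ _ _ h => exact ihv _ h (hv.step h)
  induction m generalizing u v with
  | var i => exact key hu hv _ nofun
  | zero => exact key hu hv _ nofun
  | succ m ih =>
    refine key hu hv _ fun n hn u v hu hv => ?_
    cases hn
    have hrec := ih hu hv
    rw [Red] at hv
    have happ := hv (numeral n)
    rw [Formula.inst, Formula.subst, Red] at happ
    have := happ _ hrec
    rw [Formula.subst_subst] at this
    -- Instantiating `A(S α)` at the numeral is instantiating `A` at its successor.
    convert this using 2
    rw [Formula.inst]
    congr 1
    funext i
    cases i <;> rfl

/-! ## Adequacy -/

/-- The form suited to induction: the substitutions are total and arbitrary, constrained only at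
declared proof variables. -/
theorem Derives.red_subst {Γ Δ : List Formula} {w : Tm} {A : Formula} (hw : Derives Γ Δ w A)
    (σ : ℕ → Trm) (τ : ℕ → Tm)
    (hτ : ∀ i B, Γ[i]? = some B → Red (B.subst σ) (τ i)) :
    Red (A.subst σ) (w.subst τ σ) := by
  have hcons : ∀ {Γ : List Formula} {σ : ℕ → Trm} {τ : ℕ → Tm} {B : Formula} {u : Tm},
      (∀ i B, Γ[i]? = some B → Red (B.subst σ) (τ i)) → Red (B.subst σ) u →
      ∀ i B', (B :: Γ)[i]? = some B' → Red (B'.subst σ) (scons u τ i) := by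
    intro Γ σ τ B u hτ hu i B' hi
    cases i with
    | zero => cases hi; exact hu
    | succ i => exact hτ i B' hi
  -- Entering a numeric binder: a shifted formula does not see the new entry `m`, so the same proof
  -- terms stay reducible.
  have hshift : ∀ {Γ : List Formula} {σ : ℕ → Trm} {τ : ℕ → Tm} {m : Trm},
      (∀ i B, Γ[i]? = some B → Red (B.subst σ) (τ i)) →
      ∀ i B, (Γ.map Formula.shift)[i]? = some B → Red (B.subst (scons m σ)) (τ i) := by
    intro Γ σ τ m hτ i B hi
    rw [List.getElem?_map, Option.map_eq_some_iff] at hi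
    obtain ⟨B', hi, rfl⟩ := hi
    rw [Formula.shift_subst_scons]
    exact hτ i B' hi
  induction hw generalizing σ τ with
  | var hi => exact hτ _ _ hi
  | hyp => exact Red.hyp _ _
  | wit => exact Red.wit _ _
  | andI _ _ ihu iht => exact Red.pair (ihu σ τ hτ) (iht σ τ hτ)
  | andE0 _ ih =>
    have := ih σ τ hτ
    rw [Formula.subst, Red] at this
    exact this.1
  | andE1 _ ih =>
    have := ih σ τ hτ
    rw [Formula.subst, Red] at this
    exact this.2
  | impE _ _ iht ihu =>
    have := iht σ τ hτ
    rw [Formula.subst, Red] at this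
    exact this _ (ihu σ τ hτ)
  | impI _ ih =>
    refine Red.lam fun u hu => ?_
    rw [Tm.subst_up_inst]
    exact ih _ _ (hcons hτ hu)
  | orI0 _ ih => exact Red.inl (ih σ τ hτ)
  | orI1 _ ih => exact Red.inr (ih σ τ hτ)
  | orE _ _ _ iht ih₁ ih₂ =>
    refine Red.orE (iht σ τ hτ) (fun u hu => ?_) (fun u hu => ?_) <;> rw [Tm.subst_up_inst]
    · exact ih₁ _ _ (hcons hτ hu)
    · exact ih₂ _ _ (hcons hτ hu)
  | allE m _ ih =>
    have := ih σ τ hτ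
    rw [Formula.subst, Red] at this
    rw [Formula.inst_subst, ← Formula.subst_up_inst]
    exact this _
  | allI _ ih =>
    refine Red.lamT fun m => ?_
    rw [Tm.subst_upT_instT, Formula.subst_up_inst]
    exact ih _ _ (hshift hτ)
  | exI m _ ih =>
    refine Red.exI ?_
    rw [Formula.subst_up_inst, ← Formula.inst_subst]
    exact ih σ τ hτ
  | exE _ _ iht ihw =>
    refine Red.exE (iht σ τ hτ) fun m u hu => ?_
    rw [Formula.subst_up_inst] at hu
    have := ihw _ _ (hcons (hshift hτ) hu)
    rwa [Formula.shift_subst_scons, ← Tm.subst_up_upT_inst] at this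
  | ind m _ _ ihu ihv =>
    have hu := ihu σ τ hτ
    have hv := ihv σ τ hτ
    rw [Formula.inst_subst, ← Formula.subst_up_inst] at hu ⊢
    refine Red.recN hu ?_ _
    convert hv using 1
    -- Replacing the induction variable by its successor commutes with `σ` moved under the binder.
    simp only [Formula.subst, Formula.subst_subst]
    congr 3
    funext i
    cases i with
    | zero => rfl
    | succ i =>
      simp only [Trm.up, scons, Trm.subst_subst]
      rfl
  | post _ _ _ ih =>
    simp only [Formula.subst, Red] at ih ⊢
    exact SN.post fun i => ih i σ τ hτ
  | post0 =>
    simp only [Formula.subst, Red]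
    exact SN.tt
  | nem _ _ ih₁ ih₂ => exact Red.par (ih₁ σ τ hτ) (ih₂ σ τ hτ)

end HANEM

theorem mainTheorem3 (Γ Δ : List HANEM.Formula) (w : HANEM.Tm) (A : HANEM.Formula)
    (hw : HANEM.Derives Γ Δ w A)
    (k : ℕ) (α : Fin k → ℕ) (hα : Function.Injective α)
    (hΓ : ∀ B ∈ Γ, B.fv ⊆ Set.range α) (hΔ : ∀ B ∈ Δ, B.fv ⊆ Set.range α)
    (hA : A.fv ⊆ Set.range α)
    (r : Fin k → HANEM.Trm) (t : Fin Γ.length → HANEM.Tm)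
    (ht : ∀ i : Fin Γ.length,
      HANEM.Red ((Γ.get i).subst (Function.extend α r HANEM.Trm.var)) (t i)) :
    HANEM.Red (A.subst (Function.extend α r HANEM.Trm.var))
      (w.subst (Function.extend (fun i : Fin Γ.length => (i : ℕ)) t HANEM.Tm.var)
        (Function.extend α r HANEM.Trm.var)) := by
  refine hw.red_subst _ _ fun i B hi => ?_
  obtain ⟨hlt, rfl⟩ := List.getElem?_eq_some_iff.1 hi
  -- Indices are distinct, so the extension by variables returns the given term at each declared
  -- position.
  have := Function.Injective.extend_apply (f := fun i : Fin Γ.length => (i : ℕ))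
    Fin.val_injective t HANEM.Tm.var ⟨i, hlt⟩
  simp only at this
  rw [this]
  exact ht ⟨i, hlt⟩
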